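/- Let $n\ge 2$, $\alpha\in(0,1)$, and let $\Omega\subset\mathbb{R}^n$ be a nonempty bounded open convex set with boundary of class $C^{2,\alpha}$ which is strongly convex, i.e. the second fundamental form of $\partial\Omega$ with respect to the interior unit normal $\nu$ is positive definite at every point of $\partial\Omega$. Let $T>0$, let $a\colon\Omega\times(0,T]\to\mathbb{R}$ be an arbitrary function, and let $u_0\in C^1(\overline\Omega)$ with $u_0=0$ on $\partial\Omega$. Let $u\in C^1(\overline\Omega\times[0,T])$ be such that $u(\cdot,t)\in C^2(\Omega)$ for each $t\in(0,T]$, and suppose that $u>0$ in $\Omega\times(0,T]$ and $$ \begin{cases} u_t-\Delta u=a(x,t)\,u & \text{in }\Omega\times(0,T],\\ u=0 & \text{on }\partial\Omega\times[0,T],\\ D_xu\cdot\nu>0 & \text{on }\partial\Omega\times[0,T],\\ u=u_0 & \text{on }\overline\Omega\times\{0\}. \end{cases} $$ Assume moreover that $u_0$ is log-concave, i.e. $u_0>0$ in $\Omega$ and $\log u_0$ is concave in $\Omega$. For a function $v=v(x,t)$, $x_1,x_3\in\Omega$ and $\lambda\in[0,1]$ put $$\mathcal{C}^*_v(x_1,x_3,\lambda,t):=v\big(\lambda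 x_3+(1-\lambda)x_1,t\big)-\lambda v(x_3,t)-(1-\lambda)v(x_1,t),$$ and write $f^-:=\max\{0,-f\}$. Then $$\inf_{\Omega\times\Omega\times[0,1]\times[0,T]}\mathcal{C}^*_{\log u}\;\ge\;-e\,T\sup_{\Omega\times\Omega\times[0,1]\times(0,T]}\big(\mathcal{C}^*_{a}\big)^-,$$ where the infimum and the supremum are taken in $[-\infty,+\infty]$. -/

import Mathlib

open Set

noncomputable section

/-- `ℝⁿ` with its Euclidean norm. -/
abbrev Eucl (n : ℕ) : Type := EuclideanSpace ℝ (Fin n)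

/-- `ρ` is a `C²` defining function of `Ω` on the open neighbourhood `U` of `p`:
`Ω ∩ U = {ρ > 0} ∩ U` and the gradient of `ρ` does not vanish at `p`. -/
structure IsLocalDefiningFunction {n : ℕ} (Ω : Set (Eucl n)) (p : Eucl n)
    (U : Set (Eucl n)) (ρ : Eucl n → ℝ) : Prop where
  isOpen : IsOpen U
  mem : p ∈ U
  contDiffOn : ContDiffOn ℝ 2 ρ U
  mem_iff : ∀ x ∈ U, x ∈ Ω ↔ 0 < ρ x
  gradient_ne : gradient ρ p ≠ 0

/-- `ν` is the interior unit normal to `∂Ω` at `p`. -/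
def IsInteriorUnitNormal {n : ℕ} (Ω : Set (Eucl n)) (p ν : Eucl n) : Prop :=
  ∃ U ρ, IsLocalDefiningFunction Ω p U ρ ∧ ν = ‖gradient ρ p‖⁻¹ • gradient ρ p

/-- The second fundamental form at `p`, evaluated at `(τ, τ)`, of the hypersurface `{ρ = 0}` with
respect to the unit normal `∇ρ / |∇ρ|` (for `τ` orthogonal to `∇ρ(p)`). With `ρ(x', xₙ) = xₙ - ψ(x')`
and `∇ψ(p') = 0` it is `D²ψ(p')(τ, τ)`. -/
def secondFundamentalForm {n : ℕ} (ρ : Eucl n → ℝ) (p τ : Eucl n) : ℝ :=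
  -(fderiv ℝ (fderiv ℝ ρ) p τ τ) / ‖gradient ρ p‖

/-- Bounded, strongly convex domains with `C^{2,α}` boundary: a nonempty bounded open convex set,
given near each boundary point as `{ρ > 0}` for a `C^{2,α}` function `ρ` with nonzero gradient there,
such that the second fundamental form of the boundary with respect to the interior normal is positive
definite on the tangent space at each boundary point. (The second fundamental form does not depend
on the choice of `ρ`.) -/
structure IsSmoothStronglyConvexDomain {n : ℕ} (α : NNReal) (Ω : Set (Eucl n)) : Prop where
  isOpen : IsOpen Ω
  nonempty : Ω.Nonempty
  bounded : Bornology.IsBounded Ω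
  convex : Convex ℝ Ω
  boundary : ∀ p ∈ frontier Ω, ∃ U ρ, IsLocalDefiningFunction Ω p U ρ ∧
    (∃ C : NNReal, HolderOnWith C α (fderiv ℝ (fderiv ℝ ρ)) U) ∧
    ∀ τ : Eucl n, inner ℝ (gradient ρ p) τ = 0 → τ ≠ 0 → 0 < secondFundamentalForm ρ p τ

/-- A positive function `f` on `Ω` such that `log f` is concave on `Ω`. -/
def LogConcaveOn {n : ℕ} (Ω : Set (Eucl n)) (f : Eucl n → ℝ) : Prop :=
  (∀ x ∈ Ω, 0 < f x) ∧ ConcaveOn ℝ Ω (fun x => Real.log (f x))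

/-- The spatial concavity function
`C*_v(x₁, x₃, lam, t) = v(x₂, t) - lam v(x₃, t) - (1 - lam) v(x₁, t)`, `x₂ = lam x₃ + (1 - lam) x₁`. -/
def spatialConcavity {n : ℕ} (v : Eucl n → ℝ → ℝ) (x₁ x₃ : Eucl n) (lam t : ℝ) : ℝ :=
  v (lam • x₃ + (1 - lam) • x₁) t - lam * v x₃ t - (1 - lam) * v x₁ t

/-- `u` is a positive solution, in `C²_x(Ω) ∩ C¹(Ω̄ × [0, T])`, of the problem
`u_t - Δu = a(x, t) u` in `Ω × (0, T]`, `u = 0` and `D_x u · ν > 0` on `∂Ω × [0, T]`,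
`u(·, 0) = u₀` on `Ω̄`. -/
structure IsPositiveSolution {n : ℕ} (Ω : Set (Eucl n)) (T : ℝ) (a : Eucl n → ℝ → ℝ)
    (u₀ : Eucl n → ℝ) (u : Eucl n → ℝ → ℝ) : Prop where
  contDiffOn_space : ∀ t ∈ Ioc 0 T, ContDiffOn ℝ 2 (fun x => u x t) Ω
  contDiffOn : ContDiffOn ℝ 1 (fun z : Eucl n × ℝ => u z.1 z.2) (closure Ω ×ˢ Icc 0 T)
  pos : ∀ x ∈ Ω, ∀ t ∈ Ioc 0 T, 0 < u x t
  equation : ∀ x ∈ Ω, ∀ t ∈ Ioc 0 T,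
    derivWithin (fun s => u x s) (Icc 0 T) t - Laplacian.laplacian (fun y => u y t) x
      = a x t * u x t
  boundary : ∀ p ∈ frontier Ω, ∀ t ∈ Icc 0 T, u p t = 0
  normal_deriv : ∀ p ∈ frontier Ω, ∀ t ∈ Icc 0 T, ∀ ν, IsInteriorUnitNormal Ω p ν →
    0 < fderivWithin ℝ (fun x => u x t) (closure Ω) p ν
  initial : ∀ x ∈ closure Ω, u x 0 = u₀ x

end

open Filter Topology

/-! The proof is a maximum principle for the three-point function C = `spatialConcavity` of v = log
u. Dividing the equation by u gives v_t = Δu/u + a. At an interior spatial minimum of C with λ in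
(0,1), the logarithmic gradients at the three points agree. Moving all three points by the same
vector then shows that the concavity function of Δu/u is nonnegative
(`concavity_laplacian_div_nonneg`), because the squared-gradient terms cancel. Hence C_t is at least
the concavity function of a, so at least -S, where S is the supremum on the right-hand side.
Comparison with a linear function of time yields C ≥ -S t, which is stronger than the claim because
e ≥ 1.

The difficulty is that v = -∞ on the boundary, so the existence of a minimum needs an argument.
`eventually_neg_lt_spatialConcavity` shows that negative values of C bounded away from 0 cannot
accumulate where an endpoint reaches the boundary. If the intermediate point stays inside, the
divergence of v has the favourable sign. If it also reaches the boundary, strong convexity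
(`closure_segment`) makes the limit triple degenerate. There v is the concave initial datum log u₀
plus log(u/u₀), and the latter has boundary limits because both normal derivatives are positive
(`exists_tendsto_log_sub`). -/

/-- If c were negative, the strict second-derivative test would make the point a local maximum as
well. The function would then be locally constant, forcing c = 0. -/
theorem IsLocalMin.second_deriv_nonneg {φ φ' : ℝ → ℝ} {a c : ℝ} (h : IsLocalMin φ a)
    (hφ : ∀ᶠ s in 𝓝 a, HasDerivAt φ (φ' s) s) (hφ' : HasDerivAt φ' c a) : 0 ≤ c := by
  by_contra! hc
  have e1 : deriv φ =ᶠ[𝓝 a] φ' := hφ.mono fun s hs => hs.deriv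
  have e2 : deriv (deriv φ) a = c := by rw [e1.deriv_eq, hφ'.deriv]
  have hmax : IsLocalMax φ a :=
    isLocalMax_of_deriv_deriv_neg (by rwa [e2]) h.deriv_eq_zero hφ.self_of_nhds.continuousAt
  have hconst : φ =ᶠ[𝓝 a] fun _ => φ a := by
    filter_upwards [h, hmax] with s h1 h2 using le_antisymm h2 h1
  have : deriv (deriv φ) a = 0 := by
    rw [hconst.deriv.deriv_eq]; simp
  linarith

/-! ### Restriction of C² functions to lines -/

section Line

variable {E : Type*} [NormedAddCommGroup E] [NormedSpace ℝ E]

theorem hasDerivAt_add_smul (x e : E) (s : ℝ) : HasDerivAt (fun s : ℝ => x + s • e) e s := by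
  simpa using ((hasDerivAt_id s).smul_const e).const_add x

theorem tendsto_add_smul (x e : E) : Tendsto (fun s : ℝ => x + s • e) (𝓝 0) (𝓝 x) := by
  simpa using (hasDerivAt_add_smul x e 0).continuousAt.tendsto

theorem ContDiffAt.eventually_hasDerivAt_line {F : E → ℝ} {x : E} (hF : ContDiffAt ℝ 2 F x)
    (e : E) :
    ∀ᶠ s in 𝓝 (0 : ℝ), HasDerivAt (fun s : ℝ => F (x + s • e)) (fderiv ℝ F (x + s • e) e) s := by
  have h1 : ∀ᶠ y in 𝓝 x, DifferentiableAt ℝ F y :=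
    (hF.eventually (by simp)).mono fun y hy => hy.differentiableAt (by simp)
  filter_upwards [(tendsto_add_smul x e).eventually h1] with s hs
  exact hs.hasFDerivAt.comp_hasDerivAt s (hasDerivAt_add_smul x e s)

theorem ContDiffAt.hasDerivAt_fderiv_line {F : E → ℝ} {x : E} (hF : ContDiffAt ℝ 2 F x)
    (e : E) :
    HasDerivAt (fun s : ℝ => fderiv ℝ F (x + s • e) e) (fderiv ℝ (fderiv ℝ F) x e e) 0 := by
  have h1 : DifferentiableAt ℝ (fderiv ℝ F) x :=
    (hF.fderiv_right (m := 1) (by norm_num)).differentiableAt (by simp)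
  have h2 : HasFDerivAt (fderiv ℝ F) (fderiv ℝ (fderiv ℝ F) x) (x + (0 : ℝ) • e) := by
    simpa using h1.hasFDerivAt
  have h3 := h2.comp_hasDerivAt (0 : ℝ) (hasDerivAt_add_smul x e 0)
  exact ((ContinuousLinearMap.apply ℝ ℝ e).hasFDerivAt.comp_hasDerivAt (0 : ℝ) h3)

theorem IsLocalMin.fderiv_fderiv_nonneg_of_line {F : E → ℝ} {x : E} (hF : ContDiffAt ℝ 2 F x)
    {e : E} (h : IsLocalMin (fun s : ℝ => F (x + s • e)) 0) :
    0 ≤ fderiv ℝ (fderiv ℝ F) x e e :=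
  h.second_deriv_nonneg (hF.eventually_hasDerivAt_line e) (hF.hasDerivAt_fderiv_line e)

end Line

/-- The first and second logarithmic derivatives of a positive function on the line. -/
theorem hasDerivAt_log_of_pos {g g' : ℝ → ℝ} {c : ℝ}
    (hg : ∀ᶠ s in 𝓝 0, HasDerivAt g (g' s) s) (hg' : HasDerivAt g' c 0) (h0 : 0 < g 0) :
    (∀ᶠ s in 𝓝 0, HasDerivAt (fun s => Real.log (g s)) (g' s / g s) s) ∧
      HasDerivAt (fun s => g' s / g s) (c / g 0 - (g' 0 / g 0) ^ 2) 0 := by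
  have hc := hg.self_of_nhds.continuousAt
  refine ⟨?_, ?_⟩
  · filter_upwards [hg, hc.eventually (lt_mem_nhds h0)] with s hs hp
    exact hs.log hp.ne'
  · refine (hg'.div hg.self_of_nhds h0.ne').congr_deriv ?_
    have := h0.ne'
    field_simp

/-! ### Spatial second-order condition at a minimal triple -/

section Spatial

variable {n : ℕ}

theorem laplacian_eq_sum_fderiv_fderiv (F : Eucl n → ℝ) (x : Eucl n) :
    Laplacian.laplacian F x = ∑ i, fderiv ℝ (fderiv ℝ F) x
      (EuclideanSpace.basisFun (Fin n) ℝ i) (EuclideanSpace.basisFun (Fin n) ℝ i) := by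
  rw [InnerProductSpace.laplacian_eq_iteratedFDeriv_orthonormalBasis F
    (EuclideanSpace.basisFun (Fin n) ℝ)]
  simp [iteratedFDeriv_two_apply]

/-- At an interior spatial minimum of the concavity function of `log F`, the concavity function of
`ΔF / F` is nonnegative. -/
theorem concavity_laplacian_div_nonneg {Ω : Set (Eucl n)} (hΩ : IsOpen Ω) (hc : Convex ℝ Ω)
    {F : Eucl n → ℝ} (hF : ContDiffOn ℝ 2 F Ω) (hpos : ∀ x ∈ Ω, 0 < F x)
    {x₁ x₃ : Eucl n} (h₁ : x₁ ∈ Ω) (h₃ : x₃ ∈ Ω) {l : ℝ} (hl : l ∈ Ioo (0 : ℝ) 1)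
    (hmin : ∀ y₁ ∈ Ω, ∀ y₃ ∈ Ω,
      Real.log (F (l • x₃ + (1 - l) • x₁)) - l * Real.log (F x₃) - (1 - l) * Real.log (F x₁) ≤
      Real.log (F (l • y₃ + (1 - l) • y₁)) - l * Real.log (F y₃) - (1 - l) * Real.log (F y₁)) :
    0 ≤ Laplacian.laplacian F (l • x₃ + (1 - l) • x₁) / F (l • x₃ + (1 - l) • x₁)
      - l * (Laplacian.laplacian F x₃ / F x₃) - (1 - l) * (Laplacian.laplacian F x₁ / F x₁) := by
  have h₂ : l • x₃ + (1 - l) • x₁ ∈ Ω := hc h₃ h₁ hl.1.le (by linarith [hl.2]) (by ring)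
  set x₂ := l • x₃ + (1 - l) • x₁ with hx₂
  have hC : ∀ x ∈ Ω, ContDiffAt ℝ 2 F x := fun x hx => hF.contDiffAt (hΩ.mem_nhds hx)
  have hin : ∀ x ∈ Ω, ∀ e : Eucl n, ∀ᶠ s : ℝ in 𝓝 0, x + s • e ∈ Ω := fun x hx e =>
    (tendsto_add_smul x e).eventually (hΩ.mem_nhds hx)
  have hlog : ∀ x ∈ Ω, ∀ e : Eucl n, _ := fun x hx e =>
    hasDerivAt_log_of_pos ((hC x hx).eventually_hasDerivAt_line e)
      ((hC x hx).hasDerivAt_fderiv_line e) (by simpa using hpos x hx)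
  have hlog1 : ∀ x ∈ Ω, ∀ e : Eucl n,
      HasDerivAt (fun s : ℝ => Real.log (F (x + s • e))) (fderiv ℝ F x e / F x) 0 := by
    intro x hx e
    simpa using (hlog x hx e).1.self_of_nhds
  -- Moving only `x₁` by s e moves `x₂` by s (1 - l) e. The factor 1 - l then cancels from the
  -- first-order condition.
  have g1 : ∀ e : Eucl n, fderiv ℝ F x₁ e / F x₁ = fderiv ℝ F x₂ e / F x₂ := by
    intro e
    have hm : IsLocalMin (fun s : ℝ => Real.log (F (x₂ + s • ((1 - l) • e))) - l * Real.log (F x₃)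
        - (1 - l) * Real.log (F (x₁ + s • e))) 0 := by
      filter_upwards [hin x₁ h₁ e] with s hs
      have := hmin _ hs _ h₃
      have e1 : l • x₃ + (1 - l) • (x₁ + s • e) = x₂ + s • ((1 - l) • e) := by
        rw [hx₂]; module
      rw [e1] at this
      simpa using this
    have := hm.hasDerivAt_eq_zero (((hlog1 x₂ h₂ _).sub_const _).sub
      ((hlog1 x₁ h₁ e).const_mul (1 - l)))
    have h1l : 1 - l ≠ 0 := by linarith [hl.2]
    simp only [map_smul, smul_eq_mul] at this
    apply mul_left_cancel₀ h1l
    linear_combination -this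
  have g3 : ∀ e : Eucl n, fderiv ℝ F x₃ e / F x₃ = fderiv ℝ F x₂ e / F x₂ := by
    intro e
    have hm : IsLocalMin (fun s : ℝ => Real.log (F (x₂ + s • (l • e)))
        - l * Real.log (F (x₃ + s • e)) - (1 - l) * Real.log (F x₁)) 0 := by
      filter_upwards [hin x₃ h₃ e] with s hs
      have := hmin _ h₁ _ hs
      have e1 : l • (x₃ + s • e) + (1 - l) • x₁ = x₂ + s • (l • e) := by
        rw [hx₂]; module
      rw [e1] at this
      simpa using this
    have := hm.hasDerivAt_eq_zero (((hlog1 x₂ h₂ _).sub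
      ((hlog1 x₃ h₃ e).const_mul l)).sub_const _)
    simp only [map_smul, smul_eq_mul] at this
    apply mul_left_cancel₀ hl.1.ne'
    linear_combination -this
  -- All three points move by the same vector. By `g1` and `g3` the squared logarithmic derivatives
  -- coincide, and their weights 1, -l, -(1 - l) sum to zero.
  have key : ∀ e : Eucl n, 0 ≤ fderiv ℝ (fderiv ℝ F) x₂ e e / F x₂
      - l * (fderiv ℝ (fderiv ℝ F) x₃ e e / F x₃)
      - (1 - l) * (fderiv ℝ (fderiv ℝ F) x₁ e e / F x₁) := by
    intro e
    have hm : IsLocalMin (fun s : ℝ => Real.log (F (x₂ + s • e))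
        - l * Real.log (F (x₃ + s • e)) - (1 - l) * Real.log (F (x₁ + s • e))) 0 := by
      filter_upwards [hin x₁ h₁ e, hin x₃ h₃ e] with s hs hs'
      have := hmin _ hs _ hs'
      have e1 : l • (x₃ + s • e) + (1 - l) • (x₁ + s • e) = x₂ + s • e := by
        rw [hx₂]; module
      rw [e1] at this
      simpa using this
    have := hm.second_deriv_nonneg (φ' := fun s =>
        fderiv ℝ F (x₂ + s • e) e / F (x₂ + s • e)
        - l * (fderiv ℝ F (x₃ + s • e) e / F (x₃ + s • e))
        - (1 - l) * (fderiv ℝ F (x₁ + s • e) e / F (x₁ + s • e))) (by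
      filter_upwards [(hlog x₁ h₁ e).1, (hlog x₂ h₂ e).1, (hlog x₃ h₃ e).1] with s a1 a2 a3
      exact (a2.sub (a3.const_mul l)).sub (a1.const_mul (1 - l)))
      (((hlog x₂ h₂ e).2.sub ((hlog x₃ h₃ e).2.const_mul l)).sub
        ((hlog x₁ h₁ e).2.const_mul (1 - l)))
    simp only [zero_smul, add_zero, g1 e, g3 e] at this
    linarith
  have := Finset.sum_nonneg fun i (_ : i ∈ Finset.univ) => key (EuclideanSpace.basisFun (Fin n) ℝ i)
  rw [Finset.sum_sub_distrib, Finset.sum_sub_distrib, ← Finset.mul_sum, ← Finset.mul_sum,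
    ← Finset.sum_div, ← Finset.sum_div, ← Finset.sum_div] at this
  simpa only [laplacian_eq_sum_fderiv_fderiv] using this

end Spatial

/-! ### Geometry of the boundary -/

section Boundary

variable {n : ℕ}

theorem IsLocalDefiningFunction.nonneg_of_mem_closure {Ω U : Set (Eucl n)} {p : Eucl n}
    {ρ : Eucl n → ℝ} (h : IsLocalDefiningFunction Ω p U ρ) {x : Eucl n} (hx : x ∈ closure Ω)
    (hxU : x ∈ U) : 0 ≤ ρ x := by
  have hc : ContinuousAt ρ x := (h.contDiffOn.contDiffAt (h.isOpen.mem_nhds hxU)).continuousAt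
  by_contra! hneg
  have h1 : ∀ᶠ y in 𝓝 x, ρ y < 0 ∧ y ∈ U :=
    (hc.eventually (gt_mem_nhds hneg)).and (h.isOpen.mem_nhds hxU)
  obtain ⟨y, hy, hyΩ⟩ := mem_closure_iff_nhds.1 hx _ h1
  exact absurd ((h.mem_iff y hy.2).1 hyΩ) (not_lt.2 hy.1.le)

theorem IsLocalDefiningFunction.eq_zero {Ω U : Set (Eucl n)} (hΩ : IsOpen Ω) {p : Eucl n}
    {ρ : Eucl n → ℝ} (h : IsLocalDefiningFunction Ω p U ρ) (hp : p ∈ frontier Ω) : ρ p = 0 := by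
  rw [hΩ.frontier_eq] at hp
  exact le_antisymm (not_lt.1 fun h' => hp.2 ((h.mem_iff p h.mem).2 h'))
    (h.nonneg_of_mem_closure hp.1 h.mem)

/-- Along a nontrivial segment in the closure, a defining function is nonnegative and vanishes at an
interior boundary point. This is a minimum, so the direction is tangent and the second derivative is
nonnegative, against the positivity of the second fundamental form. -/
theorem IsSmoothStronglyConvexDomain.closure_segment {α : NNReal} {Ω : Set (Eucl n)}
    (hΩ : IsSmoothStronglyConvexDomain α Ω) {x y : Eucl n} (hx : x ∈ closure Ω)
    (hy : y ∈ closure Ω) {l : ℝ} (hl : l ∈ Ioo (0 : ℝ) 1)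
    (hp : l • y + (1 - l) • x ∈ frontier Ω) : x = y := by
  by_contra hne
  set p := l • y + (1 - l) • x with hpdef
  obtain ⟨U, ρ, hρ, -, hII⟩ := hΩ.boundary p hp
  set τ := y - x with hτ
  have hC : ContDiffAt ℝ 2 ρ p := hρ.contDiffOn.contDiffAt (hρ.isOpen.mem_nhds hρ.mem)
  have hmin : IsLocalMin (fun s : ℝ => ρ (p + s • τ)) 0 := by
    have h1 : ∀ᶠ s : ℝ in 𝓝 0, p + s • τ ∈ U :=
      (tendsto_add_smul p τ).eventually (hρ.isOpen.mem_nhds hρ.mem)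
    have h2 : ∀ᶠ s : ℝ in 𝓝 0, s ∈ Ioo (-l) (1 - l) :=
      Ioo_mem_nhds (by linarith [hl.1]) (by linarith [hl.2])
    filter_upwards [h1, h2] with s hs1 hs2
    have h0 : ρ (p + (0 : ℝ) • τ) = 0 := by simpa using hρ.eq_zero hΩ.isOpen hp
    rw [h0]
    refine hρ.nonneg_of_mem_closure ?_ hs1
    have e : p + s • τ = (l + s) • y + (1 - l - s) • x := by rw [hpdef, hτ]; module
    rw [e]
    exact hΩ.convex.closure hy hx (by linarith [hs2.1]) (by linarith [hs2.2]) (by ring)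
  have h2 := hmin.fderiv_fderiv_nonneg_of_line hC
  have h1 : fderiv ℝ ρ p τ = 0 := by
    have := hmin.hasDerivAt_eq_zero (hC.eventually_hasDerivAt_line τ).self_of_nhds
    simpa using this
  have h3 := hII τ (by
    have hd : DifferentiableAt ℝ ρ p := hC.differentiableAt (by simp)
    rw [gradient, InnerProductSpace.toDual_symm_apply, h1]) (sub_ne_zero.2 (Ne.symm hne))
  rw [secondFundamentalForm] at h3
  have : -(fderiv ℝ (fderiv ℝ ρ) p τ τ) / ‖gradient ρ p‖ ≤ 0 :=
    div_nonpos_of_nonpos_of_nonneg (by linarith) (norm_nonneg _)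
  linarith

theorem IsLocalDefiningFunction.isInteriorUnitNormal {Ω U : Set (Eucl n)} {p : Eucl n}
    {ρ : Eucl n → ℝ} (h : IsLocalDefiningFunction Ω p U ρ) :
    IsInteriorUnitNormal Ω p (‖gradient ρ p‖⁻¹ • gradient ρ p) := ⟨U, ρ, h, rfl⟩

theorem IsInteriorUnitNormal.norm_eq_one {Ω : Set (Eucl n)} {p ν : Eucl n}
    (h : IsInteriorUnitNormal Ω p ν) : ‖ν‖ = 1 := by
  obtain ⟨U, ρ, hρ, rfl⟩ := h
  rw [norm_smul, norm_inv, norm_norm, inv_mul_cancel₀ (norm_ne_zero_iff.2 hρ.gradient_ne)]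

/-- If `s` missed the frontier, `t` and the complement of its closure would separate `s`. -/
theorem IsPreconnected.inter_frontier_nonempty_of_isOpen {X : Type*} [TopologicalSpace X] {s t : Set X}
    (hs : IsPreconnected s) (ht : IsOpen t) (h1 : (s ∩ t).Nonempty) (h2 : (s ∩ tᶜ).Nonempty) :
    (s ∩ frontier t).Nonempty := by
  by_contra hemp
  have hsub : s ∩ closure t ⊆ t := fun z hz => by
    by_contra hzt
    exact hemp ⟨z, hz.1, by rw [ht.frontier_eq]; exact ⟨hz.2, hzt⟩⟩
  obtain ⟨y, hys, hyt⟩ := h2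
  obtain ⟨z, -, hz1, hz2⟩ := hs t (closure t)ᶜ ht isClosed_closure.isOpen_compl
    (fun z hz => or_iff_not_imp_right.2 fun hzc => hsub ⟨hz, not_not.1 hzc⟩) h1
    ⟨y, hys, fun hyc => hyt (hsub ⟨hys, hyc⟩)⟩
  exact hz2 (subset_closure hz1)

/-- Points of `Ω` near a boundary point `p` reach the boundary after a short walk in the direction
of the exterior normal at `p`. -/
theorem IsInteriorUnitNormal.eventually_exists_mem_frontier {Ω : Set (Eucl n)} (hΩ : IsOpen Ω)
    {p ν : Eucl n} (hp : p ∈ frontier Ω) (h : IsInteriorUnitNormal Ω p ν) {η : ℝ} (hη : 0 < η) :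
    ∀ᶠ x in 𝓝 p, x ∈ Ω → ∃ s ∈ Ioc 0 η, x - s • ν ∈ frontier Ω := by
  obtain ⟨U, ρ, hρ, hν⟩ := h
  have hC : ContDiffAt ℝ 2 ρ p := hρ.contDiffOn.contDiffAt (hρ.isOpen.mem_nhds hρ.mem)
  have hpos : 0 < fderiv ℝ ρ p ν := by
    have hg : ∀ v, fderiv ℝ ρ p v = inner ℝ (gradient ρ p) v := fun v => by
      rw [gradient, InnerProductSpace.toDual_symm_apply]
    have hn : 0 < ‖gradient ρ p‖ := norm_pos_iff.2 hρ.gradient_ne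
    rw [hg, hν, real_inner_smul_right, real_inner_self_eq_norm_sq]
    positivity
  have hd : HasDerivAt (fun s : ℝ => ρ (p + s • (-ν))) (-fderiv ℝ ρ p ν) 0 := by
    have := (hC.eventually_hasDerivAt_line (-ν)).self_of_nhds
    simpa using this
  have hneg : ∀ᶠ s : ℝ in 𝓝[>] 0, ρ (p + s • (-ν)) < 0 := by
    have hslope := (hasDerivAt_iff_tendsto_slope.1 hd).mono_left
      (nhdsWithin_mono (0 : ℝ) (fun x hx => ne_of_gt hx : Ioi (0 : ℝ) ⊆ {0}ᶜ))
    filter_upwards [hslope.eventually (gt_mem_nhds (neg_lt_zero.2 hpos)), self_mem_nhdsWithin]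
      with s hs hs0
    have hs0' : (0 : ℝ) < s := hs0
    rw [slope_def_field] at hs
    simp only [zero_smul, add_zero, hρ.eq_zero hΩ hp, sub_zero] at hs
    exact neg_of_div_neg_left hs hs0'.le
  have hU : ∀ᶠ s : ℝ in 𝓝[>] 0, p + s • (-ν) ∈ U :=
    ((tendsto_add_smul p (-ν)).mono_left nhdsWithin_le_nhds).eventually
      (hρ.isOpen.mem_nhds hρ.mem)
  have hsm : ∀ᶠ s : ℝ in 𝓝[>] 0, s ∈ Ioc 0 η := Ioc_mem_nhdsGT hη
  -- The step length is fixed at `p` first. By continuity the same step still leaves Ω from every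
  -- nearby point.
  obtain ⟨s, hs1, hs2, hs3⟩ := (hneg.and (hU.and hsm)).exists
  have hcont : ContinuousAt (fun x => ρ (x + s • (-ν))) p :=
    ContinuousAt.comp (f := fun x : Eucl n => x + s • (-ν))
      (hρ.contDiffOn.contDiffAt (hρ.isOpen.mem_nhds hs2)).continuousAt
      (by fun_prop)
  have hcont' : ContinuousAt (fun x : Eucl n => x + s • (-ν)) p := by fun_prop
  filter_upwards [hcont.eventually (gt_mem_nhds hs1),
    hcont'.eventually (hρ.isOpen.mem_nhds hs2)] with x hx1 hx2 hxΩ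
  have hout : x + s • (-ν) ∉ Ω := fun h' => absurd ((hρ.mem_iff _ hx2).1 h') (not_lt.2 hx1.le)
  have hconn : IsPreconnected ((fun r : ℝ => x + r • (-ν)) '' Icc 0 s) :=
    isPreconnected_Icc.image _ (by fun_prop)
  obtain ⟨z, ⟨r, hr, rfl⟩, hz⟩ := hconn.inter_frontier_nonempty_of_isOpen hΩ
    ⟨x, ⟨0, ⟨le_rfl, hs3.1.le⟩, by simp⟩, hxΩ⟩
    ⟨x + s • (-ν), ⟨s, ⟨hs3.1.le, le_rfl⟩, rfl⟩, hout⟩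
  refine ⟨r, ⟨lt_of_le_of_ne hr.1 ?_, hr.2.trans hs3.2⟩, ?_⟩
  · rintro rfl
    rw [hΩ.frontier_eq] at hz
    exact hz.2 (by simpa using hxΩ)
  · simpa [sub_eq_add_neg] using hz

end Boundary

/-! ### Boundary limit of log u(x,t) - log u(x,0) -/

section Ratio

/-- A `C¹` function on a convex set is strictly differentiable within it. -/
theorem ContDiffOn.eventually_norm_sub_sub_le {E : Type*} [NormedAddCommGroup E] [NormedSpace ℝ E]
    {f : E → ℝ} {K : Set E} (hf : ContDiffOn ℝ 1 f K) (hK : Convex ℝ K) (hu : UniqueDiffOn ℝ K)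
    {z₀ : E} (hz₀ : z₀ ∈ K) {ε : ℝ} (hε : 0 < ε) :
    ∃ r > 0, ∀ z ∈ K ∩ Metric.ball z₀ r, ∀ z' ∈ K ∩ Metric.ball z₀ r,
      ‖f z' - f z - fderivWithin ℝ f K z₀ (z' - z)‖ ≤ ε * ‖z' - z‖ := by
  have hc := (hf.continuousOn_fderivWithin hu le_rfl) z₀ hz₀
  obtain ⟨r, hr, h⟩ := Metric.mem_nhdsWithin_iff.1 (hc (Metric.closedBall_mem_nhds _ hε))
  refine ⟨r, hr, fun z hz z' hz' => ?_⟩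
  refine (hK.inter (convex_ball z₀ r)).norm_image_sub_le_of_norm_hasFDerivWithin_le'
    (f' := fderivWithin ℝ f K) (fun x hx => ?_) (fun x hx => ?_) hz hz'
  · exact ((hf.differentiableOn (by simp)) x hx.1).hasFDerivWithinAt.mono inter_subset_left
  · simpa [dist_eq_norm] using h ⟨hx.2, hx.1⟩

variable {n : ℕ} {α : NNReal} {Ω : Set (Eucl n)} {T : ℝ} {a : Eucl n → ℝ → ℝ} {u₀ : Eucl n → ℝ}
  {u : Eucl n → ℝ → ℝ}

theorem IsPositiveSolution.pos_Icc (hu : IsPositiveSolution Ω T a u₀ u)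
    (hpos0 : ∀ x ∈ Ω, 0 < u x 0) : ∀ x ∈ Ω, ∀ t ∈ Icc 0 T, 0 < u x t := fun x hx t ht => by
  rcases ht.1.eq_or_lt with h | h
  · exact h ▸ hpos0 x hx
  · exact hu.pos x hx t ⟨h, ht.2⟩

/-- This transfers the normal derivative condition, which concerns time slices, to the joint
derivative used in the space-time expansion. -/
theorem fderivWithin_slice {K : Set (Eucl n)} {I : Set ℝ} (hK : UniqueDiffOn ℝ K)
    (hf : ContDiffOn ℝ 1 (fun z : Eucl n × ℝ => u z.1 z.2) (K ×ˢ I)) {p : Eucl n} (hp : p ∈ K)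
    {t : ℝ} (ht : t ∈ I) (e : Eucl n) :
    fderivWithin ℝ (fun x => u x t) K p e
      = fderivWithin ℝ (fun z : Eucl n × ℝ => u z.1 z.2) (K ×ˢ I) (p, t) (e, 0) := by
  have h1 := ((hf.differentiableOn (by simp)) (p, t) ⟨hp, ht⟩).hasFDerivWithinAt
  have h2 : HasFDerivWithinAt (fun x : Eucl n => (x, t)) (ContinuousLinearMap.inl ℝ (Eucl n) ℝ) K p :=
    (hasFDerivAt_prodMk_left p t).hasFDerivWithinAt
  have hmaps : MapsTo (fun x : Eucl n => (x, t)) K (K ×ˢ I) := fun x hx => ⟨hx, ht⟩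
  have h3 := HasFDerivWithinAt.comp p h1 h2 hmaps
  have h4 := h3.fderivWithin (hK p hp)
  have h5 : ((fun z : Eucl n × ℝ => u z.1 z.2) ∘ fun x => (x, t)) = fun x => u x t := rfl
  rw [h5] at h4
  rw [h4]
  simp

/-- The quotient of the solution and its initial value converges at the boundary. -/
theorem IsPositiveSolution.exists_tendsto_log_sub (hΩ : IsSmoothStronglyConvexDomain α Ω)
    (hT : 0 < T) (hu : IsPositiveSolution Ω T a u₀ u) {p : Eucl n} (hp : p ∈ frontier Ω)
    {t₀ : ℝ} (ht₀ : t₀ ∈ Icc 0 T) (hpos0 : ∀ x ∈ Ω, 0 < u x 0) :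
    ∃ L, Tendsto (fun z : Eucl n × ℝ => Real.log (u z.1 z.2) - Real.log (u z.1 0))
      (𝓝[Ω ×ˢ Icc 0 T] (p, t₀)) (𝓝 L) := by
  set f : Eucl n × ℝ → ℝ := fun z => u z.1 z.2
  set K : Set (Eucl n × ℝ) := closure Ω ×ˢ Icc 0 T
  have hpos := hu.pos_Icc hpos0
  have h0T : (0 : ℝ) ∈ Icc 0 T := ⟨le_rfl, hT.le⟩
  have hpc : p ∈ closure Ω := frontier_subset_closure hp
  have hKc : Convex ℝ K := hΩ.convex.closure.prod (convex_Icc 0 T)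
  have hΩu : UniqueDiffOn ℝ (closure Ω) := uniqueDiffOn_convex hΩ.convex.closure
    (hΩ.nonempty.mono (interior_maximal subset_closure hΩ.isOpen))
  have hKu : UniqueDiffOn ℝ K := hΩu.prod (uniqueDiffOn_Icc hT)
  obtain ⟨U, ρ, hρ, -, -⟩ := hΩ.boundary p hp
  obtain ⟨ν, hν⟩ : ∃ ν, IsInteriorUnitNormal Ω p ν := ⟨_, hρ.isInteriorUnitNormal⟩
  set A : ℝ → ℝ := fun t => fderivWithin ℝ f K (p, t) (ν, 0) with hAdef
  have hA : ∀ t ∈ Icc 0 T, 0 < A t := fun t ht => by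
    have := hu.normal_deriv p hp t ht ν hν
    rwa [fderivWithin_slice hΩu hu.contDiffOn hpc ht] at this
  have hcont : ContinuousAt (fun w : ℝ × ℝ => Real.log w.1 - Real.log w.2) (A t₀, A 0) :=
    (ContinuousAt.log continuousAt_fst (hA t₀ ht₀).ne').sub
      (ContinuousAt.log continuousAt_snd (hA 0 h0T).ne')
  -- For x near `p`, let x - s ν be a boundary point. Since u vanishes there, u(x,t)/s is close to
  -- `A t₀` and u(x,0)/s to `A 0`, with the same s in both quotients.
  refine ⟨Real.log (A t₀) - Real.log (A 0), fun W hW => ?_⟩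
  obtain ⟨ε, hε, hεW⟩ := Metric.mem_nhds_iff.1 (hcont hW)
  have hε2 : 0 < ε / 2 := half_pos hε
  obtain ⟨r₁, hr₁, hb₁⟩ := hu.contDiffOn.eventually_norm_sub_sub_le hKc hKu
    (z₀ := (p, t₀)) ⟨hpc, ht₀⟩ hε2
  obtain ⟨r₂, hr₂, hb₂⟩ := hu.contDiffOn.eventually_norm_sub_sub_le hKc hKu
    (z₀ := (p, 0)) ⟨hpc, h0T⟩ hε2
  set r := min r₁ r₂
  have hr : 0 < r := lt_min hr₁ hr₂
  -- The radii r/2 and r/4 keep both the point and its boundary foot within distance r of `p`.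
  have hnear : ∀ᶠ z : Eucl n × ℝ in 𝓝 (p, t₀), (z.1 ∈ Ω → ∃ s ∈ Ioc 0 (r / 4),
      z.1 - s • ν ∈ frontier Ω) ∧ dist z.1 p < r / 2 ∧ dist z.2 t₀ < r :=
    ((continuous_fst.tendsto (p, t₀)).eventually
      (hν.eventually_exists_mem_frontier hΩ.isOpen hp (by positivity))).and
    (((continuous_fst.tendsto (p, t₀)).eventually (Metric.ball_mem_nhds p (half_pos hr))).and
      ((continuous_snd.tendsto (p, t₀)).eventually (Metric.ball_mem_nhds t₀ hr)))
  rw [mem_map]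
  filter_upwards [nhdsWithin_le_nhds hnear, self_mem_nhdsWithin] with z ⟨hz1, hz2, hz3⟩ hz
  obtain ⟨s, ⟨hs0, hs⟩, hy⟩ := hz1 hz.1
  have hdy : dist (z.1 - s • ν) p < r := by
    have : dist (z.1 - s • ν) z.1 ≤ r / 4 := by
      simpa [dist_eq_norm, norm_smul, hν.norm_eq_one, abs_of_pos hs0] using hs
    linarith [dist_triangle (z.1 - s • ν) z.1 p]
  have hquot : ∀ t ∈ Icc 0 T, ∀ t₁ ∈ Icc 0 T, dist t t₁ < r → (∀ w ∈ K ∩ Metric.ball (p, t₁) r,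
      ∀ w' ∈ K ∩ Metric.ball (p, t₁) r,
      ‖f w' - f w - fderivWithin ℝ f K (p, t₁) (w' - w)‖ ≤ ε / 2 * ‖w' - w‖) →
      dist (u z.1 t / s) (A t₁) < ε := by
    intro t ht t₁ ht₁ htt hb
    have h1 : ((z.1 - s • ν, t) : Eucl n × ℝ) ∈ K ∩ Metric.ball (p, t₁) r :=
      ⟨⟨frontier_subset_closure hy, ht⟩, by rw [Metric.mem_ball, Prod.dist_eq]; exact max_lt hdy htt⟩
    have h2 : ((z.1, t) : Eucl n × ℝ) ∈ K ∩ Metric.ball (p, t₁) r :=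
      ⟨⟨subset_closure hz.1, ht⟩, by
        rw [Metric.mem_ball, Prod.dist_eq]; exact max_lt (by dsimp; linarith) htt⟩
    have h3 := hb _ h1 _ h2
    have e1 : ((z.1, t) : Eucl n × ℝ) - (z.1 - s • ν, t) = s • (ν, (0 : ℝ)) := by ext <;> simp
    have e2 : f (z.1 - s • ν, t) = 0 := hu.boundary _ hy t ht
    have e3 : ‖((ν, (0 : ℝ)) : Eucl n × ℝ)‖ = 1 := by simp [Prod.norm_def, hν.norm_eq_one]
    rw [e1, e2, map_smul, norm_smul, e3, Real.norm_eq_abs, Real.norm_eq_abs, abs_of_pos hs0,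
      smul_eq_mul] at h3
    have e4 : u z.1 t / s - A t₁ = (f (z.1, t) - 0 - s * fderivWithin ℝ f K (p, t₁) (ν, 0)) / s := by
      simp only [f, A]; field_simp; ring
    rw [Real.dist_eq, e4, abs_div, abs_of_pos hs0, div_lt_iff₀ hs0]
    nlinarith
  have hm := hεW (show (u z.1 z.2 / s, u z.1 0 / s) ∈ Metric.ball (A t₀, A 0) ε by
    rw [Metric.mem_ball, Prod.dist_eq]
    refine max_lt (hquot z.2 hz.2 t₀ ht₀ hz3 fun w hw w' hw' => hb₁ w ⟨hw.1, ?_⟩ w' ⟨hw'.1, ?_⟩)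
      (hquot 0 h0T 0 h0T (by simpa using hr) fun w hw w' hw' =>
        hb₂ w ⟨hw.1, ?_⟩ w' ⟨hw'.1, ?_⟩)
    · exact Metric.ball_subset_ball (min_le_left _ _) hw.2
    · exact Metric.ball_subset_ball (min_le_left _ _) hw'.2
    · exact Metric.ball_subset_ball (min_le_right _ _) hw.2
    · exact Metric.ball_subset_ball (min_le_right _ _) hw'.2)
  have hp1 := hpos z.1 hz.1 z.2 hz.2
  have hp2 := hpos0 z.1 hz.1
  simp only [mem_preimage] at hm ⊢
  -- The two terms log s cancel in the difference.
  rw [Real.log_div hp1.ne' hs0.ne', Real.log_div hp2.ne' hs0.ne'] at hm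
  simpa using hm

end Ratio

/-! ### Concavity function near the boundary -/

section LimitAtBoundary

variable {n : ℕ} {Ω : Set (Eucl n)} {T M : ℝ} {v : Eucl n → ℝ → ℝ}

/-- If a point of the triple approaches the boundary, then the concavity function is
asymptotically nonnegative. -/
theorem eventually_neg_lt_spatialConcavity (hΩ : IsOpen Ω) (hc : Convex ℝ Ω)
    (hseg : ∀ x ∈ closure Ω, ∀ y ∈ closure Ω, ∀ l ∈ Ioo (0 : ℝ) 1,
      l • y + (1 - l) • x ∈ frontier Ω → x = y)
    (hcont : ContinuousOn (fun z : Eucl n × ℝ => v z.1 z.2) (Ω ×ˢ Icc 0 T))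
    (hbot : ∀ p ∈ frontier Ω, ∀ t ∈ Icc 0 T,
      Tendsto (fun z : Eucl n × ℝ => v z.1 z.2) (𝓝[Ω ×ˢ Icc 0 T] (p, t)) atBot)
    (hM0 : 0 ≤ M) (hM : ∀ x ∈ Ω, ∀ t ∈ Icc 0 T, v x t ≤ M)
    (hw : ∀ p ∈ closure Ω, ∀ t ∈ Icc 0 T, ∃ L,
      Tendsto (fun z : Eucl n × ℝ => v z.1 z.2 - v z.1 0) (𝓝[Ω ×ˢ Icc 0 T] (p, t)) (𝓝 L))
    (hconc : ConcaveOn ℝ Ω fun x => v x 0)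
    {ι : Type*} {G : Filter ι} {x₁ x₃ : ι → Eucl n} {l t : ι → ℝ} {p₁ p₃ : Eucl n} {l₀ t₀ : ℝ}
    (hx₁ : Tendsto x₁ G (𝓝 p₁)) (hx₃ : Tendsto x₃ G (𝓝 p₃)) (hl : Tendsto l G (𝓝 l₀))
    (ht : Tendsto t G (𝓝 t₀)) (mx₁ : ∀ᶠ i in G, x₁ i ∈ Ω) (mx₃ : ∀ᶠ i in G, x₃ i ∈ Ω)
    (ml : ∀ᶠ i in G, l i ∈ Icc (0 : ℝ) 1) (mt : ∀ᶠ i in G, t i ∈ Icc 0 T)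
    (hp₁ : p₁ ∈ closure Ω) (hp₃ : p₃ ∈ closure Ω) (hl₀ : l₀ ∈ Icc (0 : ℝ) 1)
    (ht₀ : t₀ ∈ Icc 0 T) (hout : p₁ ∉ Ω) {δ : ℝ} (hδ : 0 < δ) :
    ∀ᶠ i in G, -δ < spatialConcavity v (x₁ i) (x₃ i) (l i) (t i) := by
  have hp₁f : p₁ ∈ frontier Ω := by rw [hΩ.frontier_eq]; exact ⟨hp₁, hout⟩
  set p₂ := l₀ • p₃ + (1 - l₀) • p₁ with hp₂
  have hx₂ : Tendsto (fun i => l i • x₃ i + (1 - l i) • x₁ i) G (𝓝 p₂) :=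
    (hl.smul hx₃).add ((hl.const_sub 1).smul hx₁)
  have mx₂ : ∀ᶠ i in G, l i • x₃ i + (1 - l i) • x₁ i ∈ Ω := by
    filter_upwards [mx₁, mx₃, ml] with i h1 h3 h
    exact hc h3 h1 h.1 (by linarith [h.2]) (by ring)
  have hp₂c : p₂ ∈ closure Ω :=
    hc.closure hp₃ hp₁ hl₀.1 (by linarith [hl₀.2]) (by ring)
  have hpair : ∀ {y : ι → Eucl n} {q : Eucl n}, Tendsto y G (𝓝 q) → (∀ᶠ i in G, y i ∈ Ω) →
      Tendsto (fun i => (y i, t i)) G (𝓝[Ω ×ˢ Icc 0 T] (q, t₀)) := fun hy my =>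
    tendsto_nhdsWithin_iff.2 ⟨hy.prodMk_nhds ht, my.and mt⟩
  by_cases hp₂Ω : p₂ ∈ Ω
  · have hv₂ : Tendsto (fun i => v (l i • x₃ i + (1 - l i) • x₁ i) (t i)) G (𝓝 (v p₂ t₀)) :=
      (hcont (p₂, t₀) ⟨hp₂Ω, ht₀⟩).tendsto.comp (hpair hx₂ mx₂)
    rcases hl₀.2.eq_or_lt with h1 | h1
    -- Here `x₂` and `x₃` share an interior limit, so their contributions cancel. The divergent term
    -- has weight 1 - l tending to 0 and is controlled from one side by v ≤ M.
    · have e : p₂ = p₃ := by rw [hp₂, h1]; simp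
      have hv₃ : Tendsto (fun i => v (x₃ i) (t i)) G (𝓝 (v p₂ t₀)) := by
        rw [e] at hp₂Ω ⊢
        exact (hcont (p₃, t₀) ⟨hp₂Ω, ht₀⟩).tendsto.comp (hpair hx₃ mx₃)
      have hlim := (hv₂.sub (hl.mul hv₃)).sub ((hl.const_sub 1).mul_const M)
      rw [h1] at hlim
      have : v p₂ t₀ - 1 * v p₂ t₀ - (1 - 1) * M = 0 := by ring
      rw [this] at hlim
      filter_upwards [hlim.eventually (lt_mem_nhds (neg_lt_zero.2 hδ)), mx₁, mt, ml]
        with i h m1 mt' ml'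
      refine h.trans_le ?_
      have := mul_le_mul_of_nonneg_left (hM _ m1 _ mt') (sub_nonneg.2 ml'.2)
      rw [spatialConcavity]
      linarith
    · have hv₁ : Tendsto (fun i => v (x₁ i) (t i)) G atBot :=
        (hbot p₁ hp₁f t₀ ht₀).comp (hpair hx₁ mx₁)
      have hlv₁ : Tendsto (fun i => (1 - l i) * v (x₁ i) (t i)) G atBot :=
        (hl.const_sub 1).pos_mul_atBot (sub_pos.2 h1) hv₁
      -- The threshold makes the concavity function positive: the value at `x₂` exceeds v(p₂,t₀) -
      -- 1, and l v(x₃) ≤ M because M ≥ 0.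
      filter_upwards [hlv₁.eventually (eventually_lt_atBot (v p₂ t₀ - 1 - M)),
        hv₂.eventually (lt_mem_nhds (sub_one_lt _)), mx₃, mt, ml] with i h h' m3 mt' ml'
      have h3 : l i * v (x₃ i) (t i) ≤ M := by
        refine (mul_le_mul_of_nonneg_left (hM _ m3 _ mt') ml'.1).trans ?_
        nlinarith [ml'.2]
      rw [spatialConcavity]
      linarith
  · have hp₂f : p₂ ∈ frontier Ω := by rw [hΩ.frontier_eq]; exact ⟨hp₂c, hp₂Ω⟩
    choose! L hL using hw
    have hL₁ := hL p₁ hp₁ t₀ ht₀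
    have hL₂ := hL p₂ hp₂c t₀ ht₀
    have hL₃ := hL p₃ hp₃ t₀ ht₀
    -- Either λ is an endpoint of [0,1] in the limit, or strict convexity collapses the three points
    -- into one.
    have hL0 : L p₂ t₀ - l₀ * L p₃ t₀ - (1 - l₀) * L p₁ t₀ = 0 := by
      by_cases h0 : l₀ = 0
      · simp [hp₂, h0]
      by_cases h1 : l₀ = 1
      · simp [hp₂, h1]
      have e13 := hseg p₁ hp₁ p₃ hp₃ l₀ ⟨lt_of_le_of_ne hl₀.1 (Ne.symm h0),
        lt_of_le_of_ne hl₀.2 h1⟩ hp₂f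
      have e : p₂ = p₁ := by rw [hp₂, ← e13]; module
      rw [e, ← e13]; ring
    have hlim := ((hL₂.comp (hpair hx₂ mx₂)).sub (hl.mul (hL₃.comp (hpair hx₃ mx₃)))).sub
      ((hl.const_sub 1).mul (hL₁.comp (hpair hx₁ mx₁)))
    -- The concavity function of v - v(·,0) tends to 0, and that of v(·,0) is nonnegative.
    filter_upwards [hlim.eventually (lt_mem_nhds (show -δ < _ by linarith)), mx₁, mx₃, ml]
      with i h m1 m3 ml'
    refine h.trans_le ?_
    have := hconc.2 m3 m1 ml'.1 (sub_nonneg.2 ml'.2) (by ring)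
    simp only [smul_eq_mul] at this
    simp only [spatialConcavity, Function.comp_apply]
    linarith

end LimitAtBoundary

/-! ### Parabolic maximum principle and conclusion -/

section Main

variable {n : ℕ} {α : NNReal} {Ω : Set (Eucl n)} {T : ℝ} {a : Eucl n → ℝ → ℝ} {u₀ : Eucl n → ℝ}
  {u : Eucl n → ℝ → ℝ}

/-- The boundary analysis is stated for the first endpoint leaving Ω; this symmetry covers the other
one. -/
theorem spatialConcavity_swap (v : Eucl n → ℝ → ℝ) (x₁ x₃ : Eucl n) (l t : ℝ) :
    spatialConcavity v x₃ x₁ (1 - l) t = spatialConcavity v x₁ x₃ l t := by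
  simp only [spatialConcavity, sub_sub_cancel]
  rw [add_comm]
  ring

/-- The minimum may occur at the final time, so only backward variations are used: the direction -t
points from t to 0. -/
theorem HasDerivWithinAt.nonpos_of_isMinOn {g : ℝ → ℝ} {g' T t : ℝ}
    (hg : HasDerivWithinAt g g' (Icc 0 T) t) (ht : t ∈ Ioc 0 T)
    (hmin : ∀ s ∈ Icc 0 T, g t ≤ g s) : g' ≤ 0 := by
  have h := IsLocalMinOn.hasFDerivWithinAt_nonneg (s := Icc 0 T) (a := t) (y := -t)
    (eventually_of_mem self_mem_nhdsWithin hmin) hg.hasFDerivWithinAt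
    (mem_posTangentConeAt_of_segment_subset (by
      rw [add_neg_cancel, segment_symm, segment_eq_Icc ht.1.le]
      exact Icc_subset_Icc le_rfl ht.2))
  simp only [ContinuousLinearMap.toSpanSingleton_apply, smul_eq_mul] at h
  nlinarith [ht.1]

theorem IsPositiveSolution.hasDerivWithinAt_log (hu : IsPositiveSolution Ω T a u₀ u)
    {x : Eucl n} (hx : x ∈ Ω) {t : ℝ} (ht : t ∈ Ioc 0 T) :
    HasDerivWithinAt (fun s => Real.log (u x s))
      (Laplacian.laplacian (fun y => u y t) x / u x t + a x t) (Icc 0 T) t := by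
  have ht' : t ∈ Icc 0 T := ⟨ht.1.le, ht.2⟩
  have hp := hu.pos x hx t ht
  have h1 : DifferentiableWithinAt ℝ (fun s => u x s) (Icc 0 T) t := by
    have h2 := (hu.contDiffOn.differentiableOn (by simp)) (x, t) ⟨subset_closure hx, ht'⟩
    have h3 : DifferentiableWithinAt ℝ (fun s : ℝ => (x, s)) (Icc 0 T) t := by fun_prop
    have hmaps : MapsTo (fun s : ℝ => (x, s)) (Icc 0 T) (closure Ω ×ˢ Icc 0 T) :=
      fun s hs => ⟨subset_closure hx, hs⟩
    exact DifferentiableWithinAt.comp (g := fun z : Eucl n × ℝ => u z.1 z.2) t h2 h3 hmaps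
  refine (h1.hasDerivWithinAt.log hp.ne').congr_deriv ?_
  have := hu.equation x hx t ht
  rw [eq_add_of_sub_eq this]
  field_simp
  ring

/-- At a spatial minimum of the concavity function of `log u` over the triples in `Ω`, its time
derivative is at least the concavity function of `a`. -/
theorem IsPositiveSolution.le_deriv_of_min (hu : IsPositiveSolution Ω T a u₀ u) (hΩ : IsOpen Ω)
    (hc : Convex ℝ Ω) {x₁ x₃ : Eucl n} (h₁ : x₁ ∈ Ω) (h₃ : x₃ ∈ Ω) {l : ℝ}
    (hl : l ∈ Ioo (0 : ℝ) 1) {t : ℝ} (ht : t ∈ Ioc 0 T)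
    (hmin : ∀ y₁ ∈ Ω, ∀ y₃ ∈ Ω, spatialConcavity (fun x s => Real.log (u x s)) x₁ x₃ l t ≤
      spatialConcavity (fun x s => Real.log (u x s)) y₁ y₃ l t) :
    ∃ d, HasDerivWithinAt (fun s => spatialConcavity (fun x s => Real.log (u x s)) x₁ x₃ l s) d
      (Icc 0 T) t ∧ spatialConcavity a x₁ x₃ l t ≤ d := by
  have h₂ : l • x₃ + (1 - l) • x₁ ∈ Ω := hc h₃ h₁ hl.1.le (by linarith [hl.2]) (by ring)
  refine ⟨_, ((hu.hasDerivWithinAt_log h₂ ht).sub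
    ((hu.hasDerivWithinAt_log h₃ ht).const_mul l)).sub
    ((hu.hasDerivWithinAt_log h₁ ht).const_mul (1 - l)), ?_⟩
  have := concavity_laplacian_div_nonneg hΩ hc (hu.contDiffOn_space t ht)
    (fun x hx => hu.pos x hx t ht) h₁ h₃ hl hmin
  rw [spatialConcavity]
  linarith

theorem IsPositiveSolution.eventually_neg_lt (hΩ : IsSmoothStronglyConvexDomain α Ω)
    (hT : 0 < T) (hu : IsPositiveSolution Ω T a u₀ u) (hlog : LogConcaveOn Ω fun x => u x 0)
    {ι : Type*} {G : Filter ι} {x₁ x₃ : ι → Eucl n} {l t : ι → ℝ} {p₁ p₃ : Eucl n} {l₀ t₀ : ℝ}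
    (hx₁ : Tendsto x₁ G (𝓝 p₁)) (hx₃ : Tendsto x₃ G (𝓝 p₃)) (hl : Tendsto l G (𝓝 l₀))
    (ht : Tendsto t G (𝓝 t₀)) (mx₁ : ∀ᶠ i in G, x₁ i ∈ Ω) (mx₃ : ∀ᶠ i in G, x₃ i ∈ Ω)
    (ml : ∀ᶠ i in G, l i ∈ Icc (0 : ℝ) 1) (mt : ∀ᶠ i in G, t i ∈ Icc 0 T)
    (hp₁ : p₁ ∈ closure Ω) (hp₃ : p₃ ∈ closure Ω) (hl₀ : l₀ ∈ Icc (0 : ℝ) 1)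
    (ht₀ : t₀ ∈ Icc 0 T) (hout : p₁ ∉ Ω) {δ : ℝ} (hδ : 0 < δ) :
    ∀ᶠ i in G, -δ < spatialConcavity (fun x s => Real.log (u x s)) (x₁ i) (x₃ i) (l i) (t i) := by
  have hpos := hu.pos_Icc hlog.1
  have hcu := hu.contDiffOn.continuousOn
  have hcont : ContinuousOn (fun z : Eucl n × ℝ => Real.log (u z.1 z.2)) (Ω ×ˢ Icc 0 T) :=
    (hcu.mono (prod_mono subset_closure le_rfl)).log fun z hz => (hpos z.1 hz.1 z.2 hz.2).ne'
  have hcpt : IsCompact (closure Ω ×ˢ Icc 0 T) := hΩ.bounded.isCompact_closure.prod isCompact_Icc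
  obtain ⟨M, hM⟩ := (hcpt.image_of_continuousOn hcu).bddAbove
  refine eventually_neg_lt_spatialConcavity (M := max 0 (Real.log (max 1 M))) hΩ.isOpen hΩ.convex
    (fun x hx y hy l hl => hΩ.closure_segment hx hy hl) hcont ?_ (le_max_left _ _) ?_ ?_ hlog.2
    hx₁ hx₃ hl ht mx₁ mx₃ ml mt hp₁ hp₃ hl₀ ht₀ hout hδ
  · intro p hp t ht
    refine Real.tendsto_log_nhdsGT_zero.comp (tendsto_nhdsWithin_iff.2 ⟨?_, ?_⟩)
    · have := (hcu (p, t) ⟨frontier_subset_closure hp, ht⟩).mono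
        (prod_mono (subset_closure (s := Ω)) (le_refl (Icc 0 T)))
      have h2 := this.tendsto
      simpa only [hu.boundary p hp t ht] using h2
    · filter_upwards [self_mem_nhdsWithin] with z hz using hpos z.1 hz.1 z.2 hz.2
  · intro x hx t ht
    refine le_max_of_le_right (Real.log_le_log (hpos x hx t ht) (le_max_of_le_right ?_))
    exact hM ⟨(x, t), ⟨subset_closure hx, ht⟩, rfl⟩
  · intro p hp t ht
    by_cases hpΩ : p ∈ Ω
    · have h0 : ContinuousOn (fun z : Eucl n × ℝ => Real.log (u z.1 0)) (Ω ×ˢ Icc 0 T) :=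
        hcont.comp (f := fun z : Eucl n × ℝ => (z.1, (0 : ℝ))) (by fun_prop)
          fun z hz => ⟨hz.1, le_rfl, hT.le⟩
      exact ⟨_, ((hcont.sub h0) (p, t) ⟨hpΩ, ht⟩).tendsto⟩
    · exact hu.exists_tendsto_log_sub hΩ hT (by rw [hΩ.isOpen.frontier_eq]; exact ⟨hp, hpΩ⟩) ht
        hlog.1

/-- Adding σ t with σ slightly above S makes the differential inequality strict, so a negative
minimum is impossible. -/
theorem IsPositiveSolution.neg_mul_le_spatialConcavity (hΩ : IsSmoothStronglyConvexDomain α Ω)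
    (hT : 0 < T) (hu : IsPositiveSolution Ω T a u₀ u) (hlog : LogConcaveOn Ω fun x => u x 0)
    {S : ℝ} (hS0 : 0 ≤ S) (hS : ∀ x₁ ∈ Ω, ∀ x₃ ∈ Ω, ∀ l ∈ Icc (0 : ℝ) 1, ∀ t ∈ Ioc 0 T,
      -S ≤ spatialConcavity a x₁ x₃ l t)
    {x₁ x₃ : Eucl n} (h₁ : x₁ ∈ Ω) (h₃ : x₃ ∈ Ω) {l : ℝ} (hl : l ∈ Icc (0 : ℝ) 1)
    {t : ℝ} (ht : t ∈ Icc 0 T) :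
    -(S * t) ≤ spatialConcavity (fun x s => Real.log (u x s)) x₁ x₃ l t := by
  by_contra! hlt
  set v : Eucl n → ℝ → ℝ := fun x s => Real.log (u x s) with hv
  set g := -(S * t) - spatialConcavity v x₁ x₃ l t with hg
  have hgpos : 0 < g := by linarith
  -- The excess over S costs at most g/2 up to time T, so the perturbed function is still at most
  -- -g/2 at the offending point.
  set σ := S + g / (2 * T) with hσ
  have hσS : S < σ := by
    have : 0 < g / (2 * T) := by positivity
    linarith
  have hδ : 0 < g / 2 := half_pos hgpos
  let Φ : Eucl n × Eucl n × ℝ × ℝ → ℝ := fun q =>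
    spatialConcavity v q.1 q.2.1 q.2.2.1 q.2.2.2 + σ * q.2.2.2
  let D : Set (Eucl n × Eucl n × ℝ × ℝ) := Ω ×ˢ Ω ×ˢ Icc 0 1 ×ˢ Icc 0 T
  let D' : Set (Eucl n × Eucl n × ℝ × ℝ) := closure Ω ×ˢ closure Ω ×ˢ Icc 0 1 ×ˢ Icc 0 T
  have hD' : IsCompact D' := hΩ.bounded.isCompact_closure.prod
    (hΩ.bounded.isCompact_closure.prod (isCompact_Icc.prod isCompact_Icc))
  have hDD' : D ⊆ D' := prod_mono subset_closure (prod_mono subset_closure le_rfl)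
  have hpos := hu.pos_Icc hlog.1
  have hvcont : ContinuousOn (fun z : Eucl n × ℝ => v z.1 z.2) (Ω ×ˢ Icc 0 T) :=
    (hu.contDiffOn.continuousOn.mono (prod_mono subset_closure le_rfl)).log
      fun z hz => (hpos z.1 hz.1 z.2 hz.2).ne'
  have hΦ : ContinuousOn Φ D := by
    have c1 : ContinuousOn (fun q : Eucl n × Eucl n × ℝ × ℝ => v q.1 q.2.2.2) D :=
      hvcont.comp (f := fun q : Eucl n × Eucl n × ℝ × ℝ => (q.1, q.2.2.2)) (by fun_prop)
        fun q hq => ⟨hq.1, hq.2.2.2⟩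
    have c3 : ContinuousOn (fun q : Eucl n × Eucl n × ℝ × ℝ => v q.2.1 q.2.2.2) D :=
      hvcont.comp (f := fun q : Eucl n × Eucl n × ℝ × ℝ => (q.2.1, q.2.2.2)) (by fun_prop)
        fun q hq => ⟨hq.2.1, hq.2.2.2⟩
    have c2 : ContinuousOn (fun q : Eucl n × Eucl n × ℝ × ℝ =>
        v (q.2.2.1 • q.2.1 + (1 - q.2.2.1) • q.1) q.2.2.2) D :=
      hvcont.comp (f := fun q : Eucl n × Eucl n × ℝ × ℝ =>
        (q.2.2.1 • q.2.1 + (1 - q.2.2.1) • q.1, q.2.2.2)) (by fun_prop)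
        fun q hq => ⟨hΩ.convex hq.2.1 hq.1 hq.2.2.1.1 (sub_nonneg.2 hq.2.2.1.2) (by ring),
          hq.2.2.2⟩
    have cl : ContinuousOn (fun q : Eucl n × Eucl n × ℝ × ℝ => q.2.2.1) D := by fun_prop
    have ct : ContinuousOn (fun q : Eucl n × Eucl n × ℝ × ℝ => σ * q.2.2.2) D := by fun_prop
    exact ((c2.sub (cl.mul c3)).sub ((continuousOn_const.sub cl).mul c1)).add ct
  -- The margin -g/2 keeps this sublevel set away from triples with an endpoint on the boundary. It
  -- is therefore compact, although `D` is not.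
  set A : Set (Eucl n × Eucl n × ℝ × ℝ) := {q | q ∈ D ∧ Φ q ≤ -(g / 2)} with hA
  have hAclosed : IsClosed A := by
    refine isClosed_of_closure_subset fun q hq => ?_
    have hqD' : q ∈ D' := closure_minimal (fun z hz => hDD' hz.1) hD'.isClosed hq
    have : (𝓝[A] q).NeBot := mem_closure_iff_nhdsWithin_neBot.1 hq
    have hmem : ∀ᶠ z in 𝓝[A] q, z ∈ A := self_mem_nhdsWithin
    have tid : Tendsto id (𝓝[A] q) (𝓝 q) := tendsto_id.mono_left nhdsWithin_le_nhds
    have t1 : Tendsto (fun z : Eucl n × Eucl n × ℝ × ℝ => z.1) (𝓝[A] q) (𝓝 q.1) :=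
      (continuous_fst.tendsto q).comp tid
    have t3 : Tendsto (fun z : Eucl n × Eucl n × ℝ × ℝ => z.2.1) (𝓝[A] q) (𝓝 q.2.1) :=
      ((by fun_prop : Continuous fun z : Eucl n × Eucl n × ℝ × ℝ => z.2.1).tendsto q).comp tid
    have tl : Tendsto (fun z : Eucl n × Eucl n × ℝ × ℝ => z.2.2.1) (𝓝[A] q) (𝓝 q.2.2.1) :=
      ((by fun_prop : Continuous fun z : Eucl n × Eucl n × ℝ × ℝ => z.2.2.1).tendsto q).comp tid
    have tt : Tendsto (fun z : Eucl n × Eucl n × ℝ × ℝ => z.2.2.2) (𝓝[A] q) (𝓝 q.2.2.2) :=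
      ((by fun_prop : Continuous fun z : Eucl n × Eucl n × ℝ × ℝ => z.2.2.2).tendsto q).comp tid
    have hle : ∀ᶠ z in 𝓝[A] q,
        spatialConcavity v z.1 z.2.1 z.2.2.1 z.2.2.2 ≤ -(g / 2) := by
      filter_upwards [hmem] with z hz
      have h1 : spatialConcavity v z.1 z.2.1 z.2.2.1 z.2.2.2 + σ * z.2.2.2 ≤ -(g / 2) := hz.2
      have h2 : 0 ≤ σ * z.2.2.2 := mul_nonneg (hS0.trans hσS.le) hz.1.2.2.2.1
      linarith
    have m1 := hmem.mono fun z hz => hz.1.1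
    have m3 := hmem.mono fun z hz => hz.1.2.1
    have ml := hmem.mono fun z hz => hz.1.2.2.1
    have mt := hmem.mono fun z hz => hz.1.2.2.2
    have hq1 : q.1 ∈ Ω := by
      by_contra hout
      obtain ⟨z, hz1, hz2⟩ := ((hu.eventually_neg_lt hΩ hT hlog t1 t3 tl tt m1 m3 ml mt hqD'.1
        hqD'.2.1 hqD'.2.2.1 hqD'.2.2.2 hout hδ).and hle).exists
      exact absurd hz1 (not_lt.2 hz2)
    have hq3 : q.2.1 ∈ Ω := by
      by_contra hout
      obtain ⟨z, hz1, hz2⟩ := ((hu.eventually_neg_lt hΩ hT hlog t3 t1 (tl.const_sub 1) tt m3 m1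
        (ml.mono fun z hz => ⟨sub_nonneg.2 hz.2, sub_le_self _ hz.1⟩) mt hqD'.2.1 hqD'.1
        ⟨sub_nonneg.2 hqD'.2.2.1.2, sub_le_self _ hqD'.2.2.1.1⟩ hqD'.2.2.2 hout hδ).and hle).exists
      rw [spatialConcavity_swap] at hz1
      exact absurd hz1 (not_lt.2 hz2)
    have hqD : q ∈ D := ⟨hq1, hq3, hqD'.2.2⟩
    refine ⟨hqD, le_of_tendsto ((hΦ q hqD).tendsto.mono_left
      (nhdsWithin_mono q fun z hz => hz.1)) (hmem.mono fun z hz => hz.2)⟩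
  have hAcpt : IsCompact A := hD'.of_isClosed_subset hAclosed fun z hz => hDD' hz.1
  have hne : A.Nonempty := by
    refine ⟨(x₁, x₃, l, t), ⟨h₁, h₃, hl, ht⟩, ?_⟩
    change spatialConcavity v x₁ x₃ l t + σ * t ≤ -(g / 2)
    have h1 : g / (2 * T) * t ≤ g / 2 := by
      rw [div_mul_eq_mul_div, div_le_div_iff₀ (by positivity) two_pos]
      nlinarith [ht.2]
    have h2 : spatialConcavity v x₁ x₃ l t + σ * t = -g + g / (2 * T) * t := by
      rw [hσ]; linarith
    linarith
  obtain ⟨q, hqA, hqmin⟩ := hAcpt.exists_isMinOn hne (hΦ.mono fun z hz => hz.1)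
  have hmin : ∀ z ∈ D, Φ q ≤ Φ z := fun z hz => by
    by_cases h : z ∈ A
    · exact hqmin h
    · have : -(g / 2) < Φ z := not_le.1 fun h' => h ⟨hz, h'⟩
      exact hqA.2.trans this.le
  obtain ⟨⟨hy₁, hy₃, hm, hs⟩, hΦq⟩ := hqA
  obtain ⟨y₁, y₃, m, s⟩ := q
  dsimp only at hy₁ hy₃ hm hs
  have hneg : spatialConcavity v y₁ y₃ m s < 0 := by
    have h1 : spatialConcavity v y₁ y₃ m s + σ * s ≤ -(g / 2) := hΦq
    have h2 : 0 ≤ σ * s := mul_nonneg (hS0.trans hσS.le) hs.1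
    linarith
  have hs0 : s ∈ Ioc 0 T := by
    refine ⟨lt_of_le_of_ne hs.1 ?_, hs.2⟩
    rintro rfl
    have := hlog.2.2 hy₃ hy₁ hm.1 (sub_nonneg.2 hm.2) (by ring)
    simp only [smul_eq_mul] at this
    simp only [spatialConcavity, hv] at hneg
    linarith
  have hm0 : m ∈ Ioo (0 : ℝ) 1 := by
    refine ⟨lt_of_le_of_ne hm.1 ?_, lt_of_le_of_ne hm.2 ?_⟩
    · rintro rfl
      simp [spatialConcavity] at hneg
    · rintro rfl
      simp [spatialConcavity] at hneg
  obtain ⟨d, hd, hd'⟩ := hu.le_deriv_of_min hΩ.isOpen hΩ.convex hy₁ hy₃ hm0 hs0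
    fun z₁ hz₁ z₃ hz₃ => by
      have : spatialConcavity v y₁ y₃ m s + σ * s ≤ spatialConcavity v z₁ z₃ m s + σ * s :=
        hmin (z₁, z₃, m, s) ⟨hz₁, hz₃, hm, hs⟩
      linarith
  -- At the minimum d + σ ≤ 0, whereas d ≥ -S > -σ.
  have hder := hd.add ((hasDerivAt_id s).hasDerivWithinAt.const_mul σ)
  have := hder.nonpos_of_isMinOn hs0 fun r hr => hmin (y₁, y₃, m, r) ⟨hy₁, hy₃, hm, hr⟩
  have := hS y₁ hy₁ y₃ hy₃ m hm s hs0
  linarith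

end Main

theorem theorem1p8 (n : ℕ) (hn : 2 ≤ n) (α : NNReal) (hα₀ : 0 < α) (hα₁ : α < 1)
    (Ω : Set (Eucl n)) (hΩ : IsSmoothStronglyConvexDomain α Ω)
    (T : ℝ) (hT : 0 < T) (a : Eucl n → ℝ → ℝ)
    (u₀ : Eucl n → ℝ) (hu₀ : ContDiffOn ℝ 1 u₀ (closure Ω)) (hu₀_bdry : ∀ p ∈ frontier Ω, u₀ p = 0)
    (u : Eucl n → ℝ → ℝ) (hu : IsPositiveSolution Ω T a u₀ u)
    (hlog : LogConcaveOn Ω u₀) :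
    (⨅ x₁ ∈ Ω, ⨅ x₃ ∈ Ω, ⨅ lam ∈ Icc (0 : ℝ) 1, ⨅ t ∈ Icc (0 : ℝ) T,
        ((spatialConcavity (fun x s => Real.log (u x s)) x₁ x₃ lam t : ℝ) : EReal))
      ≥ -((Real.exp 1 * T : ℝ) : EReal) *
        (⨆ x₁ ∈ Ω, ⨆ x₃ ∈ Ω, ⨆ lam ∈ Icc (0 : ℝ) 1, ⨆ t ∈ Ioc (0 : ℝ) T,
          ((max 0 (-spatialConcavity a x₁ x₃ lam t) : ℝ) : EReal)) := by

  have hinit : ∀ x ∈ Ω, u x 0 = u₀ x := fun x hx => hu.initial x (subset_closure hx)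
  have hlog' : LogConcaveOn Ω fun x => u x 0 :=
    ⟨fun x hx => (hlog.1 x hx).trans_eq (hinit x hx).symm,
      hlog.2.congr fun x hx => by simp only [hinit x hx]⟩
  set Sup : EReal := ⨆ x₁ ∈ Ω, ⨆ x₃ ∈ Ω, ⨆ lam ∈ Icc (0 : ℝ) 1, ⨆ t ∈ Ioc (0 : ℝ) T,
    ((max 0 (-spatialConcavity a x₁ x₃ lam t) : ℝ) : EReal) with hSup
  have hle : ∀ x₁ ∈ Ω, ∀ x₃ ∈ Ω, ∀ lam ∈ Icc (0 : ℝ) 1, ∀ t ∈ Ioc (0 : ℝ) T,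
      ((max 0 (-spatialConcavity a x₁ x₃ lam t) : ℝ) : EReal) ≤ Sup :=
    fun x₁ h₁ x₃ h₃ lam hlam t ht =>
      le_iSup₂_of_le x₁ h₁ <| le_iSup₂_of_le x₃ h₃ <| le_iSup₂_of_le lam hlam <|
        le_iSup₂_of_le t ht le_rfl
  have hSup0 : 0 ≤ Sup := by
    obtain ⟨x, hx⟩ := hΩ.nonempty
    refine le_trans ?_ (hle x hx x hx 0 ⟨le_rfl, zero_le_one⟩ T ⟨hT, le_rfl⟩)
    exact_mod_cast le_max_left _ _
  have heT : 0 < Real.exp 1 * T := by positivity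
  refine le_iInf₂ fun x₁ h₁ => le_iInf₂ fun x₃ h₃ => le_iInf₂ fun lam hlam =>
    le_iInf₂ fun t ht => ?_
  -- An infinite supremum makes the right-hand side -∞; `bot` is excluded by `hSup0`.
  induction hS : Sup with
  | bot => simp [hS] at hSup0
  | top =>
    rw [← EReal.coe_neg, EReal.coe_mul_top_of_neg (neg_lt_zero.2 heT)]
    exact bot_le
  | coe S =>
    rw [hS] at hSup0 hle
    have hS0 : 0 ≤ S := by exact_mod_cast hSup0
    have key := hu.neg_mul_le_spatialConcavity hΩ hT hlog' hS0
      (fun y₁ k₁ y₃ k₃ l hl s hs => by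
        have : max 0 (-spatialConcavity a y₁ y₃ l s) ≤ S := by
          exact_mod_cast hle y₁ k₁ y₃ k₃ l hl s hs
        linarith [(le_max_right 0 (-spatialConcavity a y₁ y₃ l s)).trans this])
      h₁ h₃ hlam ht
    have hexp : (1 : ℝ) ≤ Real.exp 1 := Real.one_le_exp zero_le_one
    have hfin : -(Real.exp 1 * T) * S ≤ -(S * t) := by
      have h1 : S * t ≤ S * T := mul_le_mul_of_nonneg_left ht.2 hS0
      have h2 : 0 ≤ (Real.exp 1 - 1) * (S * T) :=
        mul_nonneg (sub_nonneg.2 hexp) (mul_nonneg hS0 hT.le)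
      linarith
    exact_mod_cast hfin.trans key
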